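/- Let $\mathcal L_\infty$ be the set of (simple, labelled) infinite graphs with vertex set $\mathbb N=\{1,2,\dots\}$, identified with the product space $\{0,1\}^{E(K_\infty)}$, where $E(K_\infty)$ is the edge set of the complete graph on $\mathbb N$, and equipped with the product $\sigma$-field. A probability distribution on $\mathcal L_\infty$ is *exchangeable* if it is invariant under every permutation of the vertex set $\mathbb N$, and a random infinite graph (a random element of $\mathcal L_\infty$) is exchangeable if its distribution is. For $G\in\mathcal L_\infty$ and $S\subseteq\mathbb N$, let $G|_S$ be the subgraph of $G$ induced by $S$; write $[k]=\{1,\dots,k\}$ and $[n,\infty)=\{n,n+1,\dots\}$. For a graph $F$ with $V(F)\subset\mathbb N$, $G\supset F$ means that every edge of $F$ is an edge of $G$. **Theorem.** Let $H$ be an exchangeable random infinite graph. Then the following are equivalent. (i) The distribution of $H$ is an extreme point of the (convex) set of exchangeable probability distributions on $\mathcal L_\infty$. (ii) If $F_1$ and $F_2$ are two finite graphs with disjoint vertex sets $V(F_1),V(F_2)\subset\mathbb N$, then $$\mathbb P(H\supset F_1\cup F_2)=\mathbb P(H\supset F_1)\,\mathbb P(H\supset F_2).$$ (iii) The restrictions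 $H|_{[k]}$ and $H|_{[k+1,\infty)}$ are independent for every $k\ge 1$. (iv) Let $\mathcal F_n$ be the $\sigma$-field generated by $H|_{[n,\infty)}$. Then the tail $\sigma$-field $\bigcap_{n=1}^\infty\mathcal F_n$ is trivial, i.e., it contains only events with probability $0$ or $1$. -/

import Mathlib

open MeasureTheory ProbabilityTheory
open scoped NNReal

/-- `permute σ G` is the graph `G` with its vertices permuted by `σ`:
`ij` is an edge of it iff `σ(i)σ(j)` is an edge of `G`. -/
def permute (σ : Equiv.Perm ℕ+) (G : SimpleGraph ℕ+) : SimpleGraph ℕ+ :=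
  G.comap σ

/-- The set of exchangeable distributions: the probability measures on the space of labelled
infinite graphs with vertex set `{1, 2, …}` (with its product σ-field) that are invariant under
every permutation of the vertices. -/
def exchangeableLaws : Set (Measure (SimpleGraph ℕ+)) :=
  {μ | IsProbabilityMeasure μ ∧ ∀ σ : Equiv.Perm ℕ+, μ.map (permute σ) = μ}

/-- A random infinite graph `H` is exchangeable if its distribution is invariant under every
permutation of the vertices. -/
def IsExchangeable {Ω : Type*} [MeasurableSpace Ω] (P : Measure Ω)
    (H : Ω → SimpleGraph ℕ+) : Prop :=
  ∀ σ : Equiv.Perm ℕ+, P.map (fun ω => permute σ (H ω)) = P.map H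

/-- A graph `F` with vertex set `F.verts ⊆ {1, 2, …}` is the same thing as a subgraph of the
complete graph on `{1, 2, …}`. -/
abbrev LabelledGraph : Type := (⊤ : SimpleGraph ℕ+).Subgraph

/-- `G ⊇ F`: every edge of `F` is an edge of `G`. -/
def Contains (G : SimpleGraph ℕ+) (F : LabelledGraph) : Prop :=
  ∀ ⦃i j : ℕ+⦄, F.Adj i j → G.Adj i j

/-- The σ-field on `Ω` generated by the restriction of `H` to `[n, ∞)`. -/
abbrev restrictionSigma {Ω : Type*} (H : Ω → SimpleGraph ℕ+) (n : ℕ+) : MeasurableSpace Ω :=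
  MeasurableSpace.comap (fun ω => (H ω).induce (Set.Ici n)) inferInstance

/-- The tail σ-field of `H`. -/
abbrev tailSigma {Ω : Type*} (H : Ω → SimpleGraph ℕ+) : MeasurableSpace Ω :=
  ⨅ n : ℕ+, restrictionSigma H n

/-! Extreme ⇒ independent: for an event `B` of `G|_[k]`, the law is a mixture of the laws of the
graph shifted by `k`, conditioned on `B` and on `Bᶜ`. Both are exchangeable, so extremality makes
each equal to the whole law (`indep_of_mem_extremePoints`).

Independence ⇔ the product formula: containment events form a generating π-system; conversely,
exchangeability allows two disjoint finite graphs to be moved to opposite sides of a cut.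

Independence ⇒ trivial tail is Kolmogorov's zero-one law. Trivial tail ⇒ extreme: a copy on `ℕ+` of
the translation of `ℤ` pushes finite vertex sets to infinity, so events invariant under it are tail
events up to null sets. The law is thus ergodic, and an ergodic law equals every invariant
probability law absolutely continuous to it, hence any component of a mixture. -/

/-- The σ-field on `Ω` generated by the restriction of `H` to `S`. -/
abbrev inducedSigma {Ω : Type*} (H : Ω → SimpleGraph ℕ+) (S : Set ℕ+) : MeasurableSpace Ω :=
  MeasurableSpace.comap (fun ω => (H ω).induce S) inferInstance

/-! ### σ-fields of induced subgraphs -/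

/-- The events `H ⊇ F`, for the finite graphs `F` with vertices in `S`. -/
def containmentEvents {Ω : Type*} (H : Ω → SimpleGraph ℕ+) (S : Set ℕ+) : Set (Set Ω) :=
  {A | ∃ F : LabelledGraph, F.verts.Finite ∧ F.verts ⊆ S ∧ {ω | Contains (H ω) F} = A}

lemma contains_sup (G : SimpleGraph ℕ+) (F₁ F₂ : LabelledGraph) :
    Contains G (F₁ ⊔ F₂) ↔ Contains G F₁ ∧ Contains G F₂ := by
  simp only [Contains, SimpleGraph.Subgraph.sup_adj]
  exact ⟨fun h => ⟨fun i j hij => h (.inl hij), fun i j hij => h (.inr hij)⟩,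
    fun h i j hij => hij.elim (fun h' => h.1 h') (fun h' => h.2 h')⟩

lemma setOf_contains_sup {Ω : Type*} (H : Ω → SimpleGraph ℕ+) (F₁ F₂ : LabelledGraph) :
    {ω | Contains (H ω) (F₁ ⊔ F₂)} = {ω | Contains (H ω) F₁} ∩ {ω | Contains (H ω) F₂} := by
  ext ω
  exact contains_sup _ _ _

lemma isPiSystem_containmentEvents {Ω : Type*} (H : Ω → SimpleGraph ℕ+) (S : Set ℕ+) :
    IsPiSystem (containmentEvents H S) := by
  rintro _ ⟨F, hF, hFS, rfl⟩ _ ⟨F', hF', hFS', rfl⟩ -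
  exact ⟨F ⊔ F', hF.union hF', Set.union_subset hFS hFS', setOf_contains_sup H F F'⟩

lemma inducedSigma_le {Ω : Type*} {H : Ω → SimpleGraph ℕ+} {S : Set ℕ+} {m : MeasurableSpace Ω}
    (h : ∀ i ∈ S, ∀ j ∈ S, i ≠ j → MeasurableSet[m] {ω | (H ω).Adj i j}) :
    inducedSigma H S ≤ m := by
  refine Measurable.comap_le (SimpleGraph.measurable_iff_adj.2 fun i j => ?_)
  by_cases hij : (i : ℕ+) = j
  · obtain rfl : i = j := Subtype.ext hij
    simp
  · exact measurableSet_setOfPred.1 (h i i.2 j j.2 hij)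

lemma measurableSet_adj_inducedSigma {Ω : Type*} (H : Ω → SimpleGraph ℕ+) {S : Set ℕ+} {i j : ℕ+}
    (hi : i ∈ S) (hj : j ∈ S) : MeasurableSet[inducedSigma H S] {ω | (H ω).Adj i j} :=
  ⟨{G | G.Adj ⟨i, hi⟩ ⟨j, hj⟩}, measurableSet_setOfPred.2
    (SimpleGraph.measurable_iff_adj.1 measurable_id _ _), rfl⟩

lemma measurableSet_contains_inducedSigma {Ω : Type*} (H : Ω → SimpleGraph ℕ+) {S : Set ℕ+}
    {F : LabelledGraph} (hF : F.verts ⊆ S) :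
    MeasurableSet[inducedSigma H S] {ω | Contains (H ω) F} := by
  have : {ω | Contains (H ω) F} = ⋂ (i) (j) (_ : F.Adj i j), {ω | (H ω).Adj i j} := by
    ext ω
    simp [Contains]
  rw [this]
  exact .iInter fun i => .iInter fun j => .iInter fun h =>
    measurableSet_adj_inducedSigma H (hF h.fst_mem) (hF h.snd_mem)

lemma inducedSigma_eq_generateFrom {Ω : Type*} (H : Ω → SimpleGraph ℕ+) (S : Set ℕ+) :
    inducedSigma H S = MeasurableSpace.generateFrom (containmentEvents H S) := by
  refine le_antisymm (inducedSigma_le fun i hi j hj hij => ?_) ?_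
  · refine .basic _ ⟨SimpleGraph.subgraphOfAdj _ (show (⊤ : SimpleGraph ℕ+).Adj i j from hij),
      by simp, by simp [Set.insert_subset_iff, hi, hj], ?_⟩
    ext ω
    simp only [Contains, SimpleGraph.subgraphOfAdj_adj, Set.mem_ofPred_eq]
    refine ⟨fun h => h rfl, fun h a b hab => ?_⟩
    rcases Sym2.eq_iff.1 hab with ⟨rfl, rfl⟩ | ⟨rfl, rfl⟩
    exacts [h, h.symm]
  · refine MeasurableSpace.generateFrom_le ?_
    rintro _ ⟨F, -, hFS, rfl⟩
    exact measurableSet_contains_inducedSigma H hFS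

lemma comap_inducedSigma {Ω Ω' : Type*} (g : Ω' → Ω) (H : Ω → SimpleGraph ℕ+) (S : Set ℕ+) :
    (inducedSigma H S).comap g = inducedSigma (H ∘ g) S :=
  MeasurableSpace.comap_comp

lemma inducedSigma_le_comap {Ω : Type*} (H : Ω → SimpleGraph ℕ+) (S : Set ℕ+) :
    inducedSigma H S ≤ MeasurableSpace.comap H inferInstance :=
  inducedSigma_le fun i _ j _ _ => ⟨{G | G.Adj i j}, measurableSet_setOfPred.2
    (SimpleGraph.measurable_iff_adj.1 measurable_id _ _), rfl⟩

lemma inducedSigma_mono {Ω : Type*} (H : Ω → SimpleGraph ℕ+) {S T : Set ℕ+} (h : S ⊆ T) :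
    inducedSigma H S ≤ inducedSigma H T :=
  inducedSigma_le fun _ hi _ hj _ => measurableSet_adj_inducedSigma H (h hi) (h hj)

lemma comap_le_of_adj {Ω : Type*} {H : Ω → SimpleGraph ℕ+} {m : MeasurableSpace Ω}
    (h : ∀ i j, MeasurableSet[m] {ω | (H ω).Adj i j}) :
    MeasurableSpace.comap H inferInstance ≤ m :=
  Measurable.comap_le (SimpleGraph.measurable_iff_adj.2 fun i j => measurableSet_setOfPred.1 (h i j))

lemma comap_eq_iSup_inducedSigma {Ω : Type*} (H : Ω → SimpleGraph ℕ+) :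
    MeasurableSpace.comap H inferInstance = ⨆ k : ℕ+, inducedSigma H (Set.Iic k) := by
  refine le_antisymm (comap_le_of_adj fun i j => ?_)
    (iSup_le fun k => inducedSigma_le_comap H _)
  exact le_iSup (fun k : ℕ+ => inducedSigma H (Set.Iic k)) (max i j) _
    (measurableSet_adj_inducedSigma H (le_max_left i j) (le_max_right i j))

lemma inducedSigma_univ {Ω : Type*} (H : Ω → SimpleGraph ℕ+) :
    inducedSigma H Set.univ = MeasurableSpace.comap H inferInstance :=
  le_antisymm (inducedSigma_le_comap H _) (comap_le_of_adj fun i j =>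
    measurableSet_adj_inducedSigma H (Set.mem_univ i) (Set.mem_univ j))

lemma inducedSigma_id_le (S : Set ℕ+) :
    inducedSigma id S ≤ (inferInstance : MeasurableSpace (SimpleGraph ℕ+)) :=
  (inducedSigma_le_comap id S).trans_eq MeasurableSpace.comap_id

/-! ### Relabelling of exchangeable laws -/

lemma measurable_comap_graph (s : ℕ+ → ℕ+) :
    Measurable (fun G : SimpleGraph ℕ+ => G.comap s) :=
  SimpleGraph.measurable_iff_adj.2 fun i j =>
    SimpleGraph.measurable_iff_adj.1 measurable_id (s i) (s j)

lemma measurable_permute (σ : Equiv.Perm ℕ+) : Measurable (permute σ) :=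
  measurable_comap_graph σ

lemma measure_eq_of_contains {μ ν : Measure (SimpleGraph ℕ+)} [IsProbabilityMeasure μ]
    [IsProbabilityMeasure ν]
    (h : ∀ F : LabelledGraph, F.verts.Finite → μ {G | Contains G F} = ν {G | Contains G F}) :
    μ = ν := by
  refine ext_of_generate_finite (containmentEvents id Set.univ) ?_
    (isPiSystem_containmentEvents _ _) ?_ (by simp)
  · rw [← inducedSigma_eq_generateFrom, inducedSigma_univ, MeasurableSpace.comap_id]
  · rintro _ ⟨F, hF, -, rfl⟩
    exact h F hF

/-- An exchangeable law is invariant under relabelling along any injection. -/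
lemma map_comap_eq_of_injective {μ : Measure (SimpleGraph ℕ+)} (hμ : μ ∈ exchangeableLaws)
    {s : ℕ+ → ℕ+} (hs : s.Injective) : μ.map (fun G => G.comap s) = μ := by
  obtain ⟨_, hinv⟩ := hμ
  have hm := measurable_comap_graph s
  have := Measure.isProbabilityMeasure_map hm.aemeasurable (μ := μ)
  refine measure_eq_of_contains fun F hF => ?_
  have := hF.to_subtype
  -- Only the finitely many vertices of `F` matter, and there the injection extends to a
  -- permutation.
  obtain ⟨σ, hσ⟩ := Equiv.Perm.exists_extending_pair (fun v : F.verts => (v : ℕ+))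
    (fun v => s v) Subtype.val_injective (hs.comp Subtype.val_injective)
  have hmeas : MeasurableSet {G : SimpleGraph ℕ+ | Contains G F} :=
    inducedSigma_id_le _ _ (measurableSet_contains_inducedSigma id (Set.subset_univ F.verts))
  conv_rhs => rw [← hinv σ]
  rw [Measure.map_apply hm hmeas, Measure.map_apply (measurable_permute σ) hmeas]
  congr 1
  ext G
  refine forall₃_congr fun i j hij => ?_
  have hi : σ i = s i := hσ ⟨i, hij.fst_mem⟩
  have hj : σ j = s j := hσ ⟨j, hij.snd_mem⟩
  simp [permute, hi, hj]

/-! ### Extremality gives independence -/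

lemma add_right_injective_pnat (k : ℕ+) : Function.Injective (fun v : ℕ+ => v + k) :=
  fun _ _ h => add_right_cancel h

lemma inducedSigma_Ici_le_comap_shift (k : ℕ+) :
    inducedSigma id (Set.Ici (k + 1)) ≤
      MeasurableSpace.comap (fun G : SimpleGraph ℕ+ => G.comap (· + k)) inferInstance := by
  refine inducedSigma_le fun i hi j hj _ => ?_
  have key : ∀ v ∈ Set.Ici (k + 1), ∃ w, w + k = v := fun v hv =>
    ⟨v - k, by rw [add_comm]; exact PNat.add_sub_of_lt (PNat.add_one_le_iff.1 hv)⟩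
  obtain ⟨i, rfl⟩ := key i hi
  obtain ⟨j, rfl⟩ := key j hj
  exact ⟨{G | G.Adj i j}, measurableSet_setOfPred.2
    (SimpleGraph.measurable_iff_adj.1 measurable_id _ _), rfl⟩

/-- Permutations that fix every vertex of `S` preserve the events depending on `G|_S`. -/
lemma permute_preimage_of_fixes {S : Set ℕ+} {σ : Equiv.Perm ℕ+} (hσ : ∀ v ∈ S, σ v = v)
    {B : Set (SimpleGraph ℕ+)} (hB : MeasurableSet[inducedSigma id S] B) :
    permute σ ⁻¹' B = B := by
  obtain ⟨C, -, rfl⟩ := hB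
  ext G
  have : (permute σ G).induce S = G.induce S := by
    ext i j
    simp [permute, hσ i i.2, hσ j j.2]
  simp [this]

/-- Conditioning on an event of `G|_[k]` leaves the shifted graph exchangeable. -/
lemma cond_map_shift_mem_exchangeableLaws {μ : Measure (SimpleGraph ℕ+)}
    (hμ : μ ∈ exchangeableLaws) (k : ℕ+) {B : Set (SimpleGraph ℕ+)}
    (hB : MeasurableSet[inducedSigma id (Set.Iic k)] B) (hB0 : μ B ≠ 0) :
    (cond μ B).map (fun G => G.comap (· + k)) ∈ exchangeableLaws := by
  obtain ⟨_, hinv⟩ := hμ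
  have hBm := inducedSigma_id_le _ _ hB
  have hs := measurable_comap_graph (· + k)
  have := cond_isProbabilityMeasure hB0
  refine ⟨Measure.isProbabilityMeasure_map hs.aemeasurable, fun σ => ?_⟩
  -- `τ` is `σ` transported beyond `k`; since it fixes `[k]`, it preserves `B`, and hence the
  -- conditional law.
  let τ : Equiv.Perm ℕ+ := σ.viaEmbedding ⟨_, add_right_injective_pnat k⟩
  have hτs : ∀ v, τ (v + k) = σ v + k := fun v =>
    Equiv.Perm.viaEmbedding_apply σ ⟨_, add_right_injective_pnat k⟩ v
  have hτ : ∀ v ∈ Set.Iic k, τ v = v := by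
    refine fun v hv => Equiv.Perm.viaEmbedding_apply_of_notMem σ _ v ?_
    rintro ⟨w, rfl⟩
    exact absurd hv (not_le.2 (PNat.lt_add_left k w))
  have hcond : (cond μ B).map (permute τ) = cond μ B := by
    ext A hA
    rw [Measure.map_apply (measurable_permute τ) hA, cond_apply hBm, cond_apply hBm]
    congr 1
    conv_rhs => rw [← hinv τ, Measure.map_apply (measurable_permute τ) (hBm.inter hA),
      Set.preimage_inter, permute_preimage_of_fixes hτ hB]
  have hcomm : permute σ ∘ (fun G : SimpleGraph ℕ+ => G.comap (· + k)) =
      (fun G : SimpleGraph ℕ+ => G.comap (· + k)) ∘ permute τ := by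
    funext G
    ext i j
    simp [permute, hτs]
  rw [Measure.map_map (measurable_permute σ) hs, hcomm,
    ← Measure.map_map hs (measurable_permute τ), hcond]

lemma indep_of_mem_extremePoints {μ : Measure (SimpleGraph ℕ+)}
    (hμ : μ ∈ Set.extremePoints ℝ≥0 exchangeableLaws) (k : ℕ+) :
    Indep (inducedSigma id (Set.Iic k)) (inducedSigma id (Set.Ici (k + 1))) μ := by
  have hex := hμ.1
  have := hex.1
  have hs := measurable_comap_graph (· + k)
  rw [Indep_iff]
  intro B C hB hC
  have hBm := inducedSigma_id_le _ _ hB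
  have hBc : MeasurableSet[inducedSigma id (Set.Iic k)] Bᶜ := hB.compl
  -- Both conditional laws and strictly positive weights are needed below, so null `B` and `Bᶜ` are
  -- settled first.
  by_cases h0 : μ B = 0
  · simp [h0, measure_mono_null (Set.inter_subset_left (s := B) (t := C)) h0]
  by_cases h1 : μ Bᶜ = 0
  · have hu : μ B = 1 := (prob_compl_eq_zero_iff hBm).1 h1
    rw [hu, one_mul, Set.inter_comm]
    exact measure_inter_conull h1
  obtain ⟨C, hCm, rfl⟩ := inducedSigma_Ici_le_comap_shift k _ hC
  have hmap : ∀ D : Set (SimpleGraph ℕ+), MeasurableSet D →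
      μ ((fun G : SimpleGraph ℕ+ => G.comap (· + k)) ⁻¹' D) = μ D := fun D hD => by
    rw [← Measure.map_apply hs hD, map_comap_eq_of_injective hex (add_right_injective_pnat k)]
  have heq : (cond μ B).map (fun G => G.comap (· + k)) = μ := by
    refine hμ.2 (cond_map_shift_mem_exchangeableLaws hex k hB h0)
      (cond_map_shift_mem_exchangeableLaws hex k hBc h1)
      ⟨(μ B).toNNReal, (μ Bᶜ).toNNReal, ENNReal.toNNReal_pos h0 (measure_ne_top _ _),
        ENNReal.toNNReal_pos h1 (measure_ne_top _ _), ?_, ?_⟩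
    · rw [← ENNReal.toNNReal_add (measure_ne_top _ _) (measure_ne_top _ _),
        prob_add_prob_compl hBm, ENNReal.toNNReal_one]
    · ext D hD
      have hcoe : ∀ E : Set (SimpleGraph ℕ+), ((μ E).toNNReal : ENNReal) = μ E :=
        fun E => ENNReal.coe_toNNReal (measure_ne_top _ _)
      rw [Measure.add_apply, Measure.smul_apply, Measure.smul_apply, Measure.map_apply hs hD,
        Measure.map_apply hs hD, ENNReal.smul_def, ENNReal.smul_def, hcoe, hcoe, smul_eq_mul,
        smul_eq_mul, mul_comm, mul_comm (μ Bᶜ), cond_mul_eq_inter hBm,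
        cond_mul_eq_inter hBm.compl, Set.inter_comm, Set.inter_comm Bᶜ, ← Set.sdiff_eq,
        measure_inter_add_sdiff _ hBm, hmap D hD]
  rw [← cond_mul_eq_inter hBm, ← Measure.map_apply hs hCm, heq, hmap C hCm, mul_comm]

/-! ### A trivial tail gives ergodicity, hence extremality -/

/-- An event depending on finitely many vertices is moved arbitrarily far out by iterating the
translation of `ℤ`, transported to `ℕ+`. -/
lemma exists_iterate_permute_far {σ : Equiv.Perm ℕ+} (e : ℕ+ ≃ ℤ)
    (hσ : ∀ v, e (σ v) = e v + 1) (k n : ℕ+) {A : Set (SimpleGraph ℕ+)}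
    (hA : MeasurableSet[inducedSigma id (Set.Iic k)] A) :
    ∃ N : ℕ, MeasurableSet[inducedSigma id (Set.Ici n)] ((permute σ)^[N] ⁻¹' A) := by
  have hiter : ∀ (N : ℕ) v, e (σ^[N] v) = e v + N := by
    intro N
    induction N with
    | zero => simp
    | succ N ih =>
      intro v
      rw [Function.iterate_succ_apply', hσ, ih]
      push_cast
      ring
  have hperm : ∀ (N : ℕ) G i j, ((permute σ)^[N] G).Adj i j ↔ G.Adj (σ^[N] i) (σ^[N] j) := by
    intro N
    induction N with
    | zero => simp
    | succ N ih =>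
      intro G i j
      rw [Function.iterate_succ_apply, ih, Function.iterate_succ_apply',
        Function.iterate_succ_apply']
      rfl
  -- `e ≥ a` on `[k]` and `e ≤ b` on `[n]`, so `b - a + 1` translations carry `[k]` off `[n]`.
  obtain ⟨a, ha⟩ := ((Set.finite_Iic k).image e).bddBelow
  obtain ⟨b, hb⟩ := ((Set.finite_Iic n).image e).bddAbove
  refine ⟨(b - a + 1).toNat, ?_⟩
  have hfar : ∀ v ∈ Set.Iic k, σ^[(b - a + 1).toNat] v ∈ Set.Ici n := by
    intro v hv
    by_contra hlt
    have h1 := hb (Set.mem_image_of_mem e (Set.mem_Iic.2 (not_le.1 hlt).le))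
    have h2 := ha (Set.mem_image_of_mem e hv)
    rw [hiter] at h1
    have := Int.self_le_toNat (b - a + 1)
    omega
  have hle : inducedSigma ((permute σ)^[(b - a + 1).toNat]) (Set.Iic k) ≤
      inducedSigma id (Set.Ici n) := by
    refine inducedSigma_le fun i hi j hj _ => ?_
    simp only [hperm]
    exact measurableSet_adj_inducedSigma id (hfar i hi) (hfar j hj)
  refine hle _ ?_
  obtain ⟨C, hC, rfl⟩ := hA
  exact ⟨C, hC, rfl⟩

lemma exists_inducedSigma_Iic_approx (μ : Measure (SimpleGraph ℕ+)) [IsProbabilityMeasure μ]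
    {E : Set (SimpleGraph ℕ+)} (hE : MeasurableSet E) {ε : ENNReal} (hε : 0 < ε) :
    ∃ k A, MeasurableSet[inducedSigma id (Set.Iic k)] A ∧ μ (symmDiff A E) < ε := by
  let C : Set (Set (SimpleGraph ℕ+)) :=
    {A | ∃ k : ℕ+, MeasurableSet[inducedSigma id (Set.Iic k)] A}
  have hmono : ∀ {k l : ℕ+}, k ≤ l → ∀ A, MeasurableSet[inducedSigma id (Set.Iic k)] A →
      MeasurableSet[inducedSigma id (Set.Iic l)] A :=
    fun h => inducedSigma_mono id (Set.Iic_subset_Iic.2 h)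
  have hring : IsSetRing C :=
    { empty_mem := ⟨1, @MeasurableSet.empty _ (inducedSigma id (Set.Iic 1))⟩
      union_mem := fun A B ⟨k, hA⟩ ⟨l, hB⟩ => ⟨max k l,
        (hmono (le_max_left k l) A hA).union (hmono (le_max_right k l) B hB)⟩
      sdiff_mem := fun A B ⟨k, hA⟩ ⟨l, hB⟩ => ⟨max k l,
        (hmono (le_max_left k l) A hA).diff (hmono (le_max_right k l) B hB)⟩ }
  have hgen : (inferInstance : MeasurableSpace (SimpleGraph ℕ+)) =
      MeasurableSpace.generateFrom C := by
    refine le_antisymm ?_ (MeasurableSpace.generateFrom_le ?_)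
    · rw [← MeasurableSpace.comap_id (m := (inferInstance : MeasurableSpace (SimpleGraph ℕ+))),
        comap_eq_iSup_inducedSigma]
      exact iSup_le fun k A hA => .basic _ ⟨k, hA⟩
    · rintro A ⟨k, hA⟩
      exact inducedSigma_id_le _ _ hA
  obtain ⟨A, ⟨k, hA⟩, h⟩ := exists_measure_symmDiff_lt_of_generateFrom_isSetRing (μ := μ) hring
    ⟨{Set.univ}, Set.countable_singleton _,
      Set.singleton_subset_iff.2 ⟨1, @MeasurableSet.univ _ (inducedSigma id (Set.Iic 1))⟩, by simp⟩ hgen hE hε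
  exact ⟨k, A, hA, h⟩

/-- An invariant `E` is approximated by an event on finitely many vertices. Iterating `σ` moves that
event far out without changing its distance to `E`. With summable errors, Borel–Cantelli identifies
`E` almost surely with the limsup of the moved events, a tail event. -/
lemma ergodic_permute_of_tail_trivial {μ : Measure (SimpleGraph ℕ+)}
    (hμ : μ ∈ exchangeableLaws) (htail : ∀ A, MeasurableSet[tailSigma id] A → μ A = 0 ∨ μ A = 1)
    {σ : Equiv.Perm ℕ+} (e : ℕ+ ≃ ℤ) (hσ : ∀ v, e (σ v) = e v + 1) :
    Ergodic (permute σ) μ := by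
  obtain ⟨_, hinv⟩ := hμ
  have hmp : MeasurePreserving (permute σ) μ μ := ⟨measurable_permute σ, hinv σ⟩
  refine ⟨hmp, ⟨fun E hE hEinv => ?_⟩⟩
  obtain ⟨ε, hε, hεsum⟩ := ENNReal.exists_pos_sum_of_countable' one_ne_zero ℕ
  have hB : ∀ n : ℕ, ∃ B, MeasurableSet[inducedSigma id (Set.Ici n.succPNat)] B ∧
      μ (symmDiff B E) < ε n := by
    intro n
    obtain ⟨k, A, hA, hAE⟩ := exists_inducedSigma_Iic_approx μ hE (hε n)
    obtain ⟨N, hN⟩ := exists_iterate_permute_far e hσ k n.succPNat hA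
    refine ⟨_, hN, ?_⟩
    have hEN : (permute σ)^[N] ⁻¹' E = E := by
      rw [Set.preimage_iterate_eq]
      exact Function.iterate_fixed hEinv N
    have hm : MeasurableSet (symmDiff A E) := (inducedSigma_id_le _ _ hA).symmDiff hE
    calc μ (symmDiff ((permute σ)^[N] ⁻¹' A) E)
        = μ ((permute σ)^[N] ⁻¹' (symmDiff A E)) := by
          rw [Set.preimage_symmDiff, hEN]
      _ = μ (symmDiff A E) := (hmp.iterate N).measure_preimage hm.nullMeasurableSet
      _ < ε n := hAE
  choose B hBm hBE using hB
  have hT : MeasurableSet[tailSigma id] (Filter.limsup B Filter.atTop) := by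
    rw [MeasurableSpace.measurableSet_iInf]
    intro n
    -- Dropping the first `n` terms leaves only events depending on `[n, ∞)`.
    have : Filter.limsup B Filter.atTop =
        Filter.limsup (fun m => B (m + n)) Filter.atTop :=
      (Filter.limsup_nat_add B n).symm
    rw [this]
    refine @MeasurableSet.measurableSet_limsup _ (restrictionSigma id n) _ fun m => ?_
    refine inducedSigma_mono id (Set.Ici_subset_Ici.2 ?_) _ (hBm (m + n))
    rw [← PNat.coe_le_coe, Nat.succPNat_coe]
    omega
  have hTm : MeasurableSet (Filter.limsup B Filter.atTop) :=
    MeasurableSet.measurableSet_limsup fun n => inducedSigma_id_le _ _ (hBm n)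
  have hlimsup : ∀ G, G ∈ Filter.limsup B Filter.atTop ↔ ∃ᶠ n in Filter.atTop, G ∈ B n :=
    fun G => Filter.mem_limsup_iff_frequently_mem
  generalize Filter.limsup B Filter.atTop = T at hT hTm hlimsup
  have hae : T =ᵐ[μ] E := by
    refine Filter.eventuallyEq_set.2 ?_
    have hsum : ∑' n, μ (symmDiff (B n) E) ≠ ⊤ :=
      ((ENNReal.tsum_le_tsum fun n => (hBE n).le).trans_lt
        (hεsum.trans ENNReal.one_lt_top)).ne
    filter_upwards [ae_eventually_notMem hsum] with G hG
    have hG' : ∀ᶠ n in Filter.atTop, G ∈ B n ↔ G ∈ E := by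
      filter_upwards [hG] with n hn
      rw [Set.mem_symmDiff] at hn
      tauto
    rw [hlimsup, Filter.frequently_congr hG', Filter.frequently_const]
  rw [Filter.eventuallyConst_set']
  rcases htail _ hT with h | h
  · exact .inl (hae.symm.trans (ae_eq_empty.2 h))
  · exact .inr (hae.symm.trans (ae_eq_univ.2 ((prob_compl_eq_zero_iff hTm).2 h)))

lemma mem_extremePoints_of_tail_trivial {μ : Measure (SimpleGraph ℕ+)}
    (hμ : μ ∈ exchangeableLaws)
    (htail : ∀ A, MeasurableSet[tailSigma id] A → μ A = 0 ∨ μ A = 1) :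
    μ ∈ Set.extremePoints ℝ≥0 exchangeableLaws := by
  obtain ⟨e⟩ : Nonempty (ℕ+ ≃ ℤ) := nonempty_equiv_of_countable
  let σ : Equiv.Perm ℕ+ := (e.trans (Equiv.addRight 1)).trans e.symm
  have hσ : ∀ v, e (σ v) = e v + 1 := fun v => by simp [σ]
  have herg := ergodic_permute_of_tail_trivial hμ htail e hσ
  have := hμ.1
  refine ⟨hμ, ?_⟩
  rintro ν₁ ⟨hp₁, hν₁⟩ ν₂ - ⟨a, b, ha, -, -, rfl⟩
  -- The weight `a` is positive, so `ν₁` is absolutely continuous with respect to the mixture.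
  refine herg.eq_of_absolutelyContinuous ⟨measurable_permute σ, hν₁ σ⟩ ?_
  exact Measure.AbsolutelyContinuous.add_right
    (Measure.absolutelyContinuous_smul (c := (a : ENNReal)) (by simpa using ha.ne')) _

/-! ### The equivalences -/

theorem theorem5p5 {Ω : Type*} [MeasurableSpace Ω] (P : Measure Ω) [IsProbabilityMeasure P]
    (H : Ω → SimpleGraph ℕ+) (hmeas : Measurable H) (hexch : IsExchangeable P H) :
    List.TFAE [
      P.map H ∈ Set.extremePoints ℝ≥0 exchangeableLaws,
      ∀ F₁ F₂ : LabelledGraph, F₁.verts.Finite → F₂.verts.Finite → Disjoint F₁.verts F₂.verts →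
        P {ω | Contains (H ω) (F₁ ⊔ F₂)} =
          P {ω | Contains (H ω) F₁} * P {ω | Contains (H ω) F₂},
      ∀ k : ℕ+, IndepFun (fun ω => (H ω).induce (Set.Iic k))
        (fun ω => (H ω).induce (Set.Ici (k + 1))) P,
      ∀ A : Set Ω, MeasurableSet[tailSigma H] A → P A = 0 ∨ P A = 1] := by
  have hle : ∀ S, inducedSigma H S ≤ _ := fun S =>
    (inducedSigma_le_comap H S).trans hmeas.comap_le
  have hex : P.map H ∈ exchangeableLaws :=
    ⟨Measure.isProbabilityMeasure_map hmeas.aemeasurable, fun σ => by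
      rw [Measure.map_map (measurable_permute σ) hmeas]
      exact hexch σ⟩
  tfae_have 1 → 3 := by
    intro h k
    rw [IndepFun_iff]
    intro A B hA hB
    change MeasurableSet[inducedSigma (id ∘ H) _] A at hA
    change MeasurableSet[inducedSigma (id ∘ H) _] B at hB
    rw [← comap_inducedSigma] at hA hB
    obtain ⟨A, hA, rfl⟩ := hA
    obtain ⟨B, hB, rfl⟩ := hB
    have hA' := inducedSigma_id_le _ _ hA
    have hB' := inducedSigma_id_le _ _ hB
    have := (Indep_iff _ _ _).1 (indep_of_mem_extremePoints h k) A B hA hB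
    rwa [Measure.map_apply hmeas (hA'.inter hB'), Measure.map_apply hmeas hA',
      Measure.map_apply hmeas hB'] at this
  tfae_have 3 → 2 := by
    classical
    intro h F₁ F₂ hF₁ hF₂ hdisj
    obtain ⟨k, hk⟩ := hF₁.bddAbove
    -- With `k` bounding `F₁.verts`, `s` keeps `F₁` inside `[k]` and sends the vertices of `F₂`
    -- beyond `k`.
    let s : ℕ+ → ℕ+ := fun v => if v ∈ F₁.verts then v else v + k
    have hs₁ : ∀ v ∈ F₁.verts, s v = v := fun v hv => if_pos hv
    have hs₂ : ∀ v ∉ F₁.verts, s v = v + k := fun v hv => if_neg hv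
    have hlt : ∀ v ∈ F₁.verts, ∀ w, v ≠ w + k := fun v hv w =>
      ((hk hv).trans_lt (PNat.lt_add_left k w)).ne
    have hs : s.Injective := by
      intro v w hvw
      by_cases hv : v ∈ F₁.verts <;> by_cases hw : w ∈ F₁.verts
      · rwa [hs₁ v hv, hs₁ w hw] at hvw
      · rw [hs₁ v hv, hs₂ w hw] at hvw
        exact absurd hvw (hlt v hv w)
      · rw [hs₂ v hv, hs₁ w hw] at hvw
        exact absurd hvw.symm (hlt w hw v)
      · rw [hs₂ v hv, hs₂ w hw] at hvw
        exact add_right_cancel hvw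
    have hcm := (measurable_comap_graph s).comp hmeas
    have hP : ∀ F : LabelledGraph,
        P {ω | Contains (H ω) F} = P {ω | Contains ((H ω).comap s) F} := fun F => by
      have hm : MeasurableSet {G : SimpleGraph ℕ+ | Contains G F} := inducedSigma_id_le _ _
        (measurableSet_contains_inducedSigma id (Set.subset_univ F.verts))
      have h1 : P {ω | Contains (H ω) F} = P.map H {G | Contains G F} :=
        (Measure.map_apply hmeas hm).symm
      rw [h1, ← map_comap_eq_of_injective hex hs, Measure.map_map (measurable_comap_graph s) hmeas,
        Measure.map_apply hcm hm]
      rfl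
    rw [hP, hP F₁, hP F₂, setOf_contains_sup (fun ω => (H ω).comap s)]
    have hsigma : ∀ (F : LabelledGraph) (S : Set ℕ+), (∀ v ∈ F.verts, s v ∈ S) →
        MeasurableSet[inducedSigma H S] {ω | Contains ((H ω).comap s) F} := fun F S hS => by
      have hle' : inducedSigma (fun ω => (H ω).comap s) F.verts ≤ inducedSigma H S :=
        inducedSigma_le fun i hi j hj _ => measurableSet_adj_inducedSigma H (hS i hi) (hS j hj)
      exact hle' _ (measurableSet_contains_inducedSigma _ subset_rfl)
    refine (Indep_iff _ _ _).1 (h k) _ _ (hsigma F₁ _ fun v hv => ?_) (hsigma F₂ _ fun v hv => ?_)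
    · rw [hs₁ v hv]
      exact hk hv
    · rw [hs₂ v (Set.disjoint_right.1 hdisj hv), add_comm v]
      exact add_le_add_right (one_le) k
  tfae_have 2 → 3 := by
    intro h k
    refine IndepSets.indep (hle _) (hle _) (isPiSystem_containmentEvents H _)
      (isPiSystem_containmentEvents H _) (inducedSigma_eq_generateFrom H _)
      (inducedSigma_eq_generateFrom H _) ?_
    rw [IndepSets_iff]
    rintro _ _ ⟨F₁, hF₁, hS₁, rfl⟩ ⟨F₂, hF₂, hS₂, rfl⟩
    rw [← setOf_contains_sup]
    refine h F₁ F₂ hF₁ hF₂ (Set.disjoint_left.2 fun v h1 h2 => ?_)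
    exact absurd (hS₂ h2) (not_le.2 (PNat.lt_add_one_iff.2 (hS₁ h1)))
  tfae_have 3 → 4 := by
    intro h A hA
    have htail : tailSigma H ≤ MeasurableSpace.comap H inferInstance :=
      (iInf_le _ 1).trans (inducedSigma_le_comap H _)
    -- The tail lies in the σ-field of `H|_[k+1, ∞)` for each `k`, so it is independent of every
    -- `H|_[k]`, hence of all of `H` and of itself.
    have hind : Indep (⨆ k : ℕ+, inducedSigma H (Set.Iic k)) (tailSigma H) P :=
      indep_iSup_of_directed_le
        (fun k => indep_of_indep_of_le_right (h k) (iInf_le _ (k + 1)))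
        (fun k => hle _) (htail.trans hmeas.comap_le)
        (directed_of_isDirected_le fun k l hkl =>
          inducedSigma_mono H (Set.Iic_subset_Iic.2 hkl))
    rw [← comap_eq_iSup_inducedSigma] at hind
    exact measure_eq_zero_or_one_of_indep_self (indep_of_indep_of_le_left hind htail) hA
  tfae_have 4 → 1 := by
    intro h
    refine mem_extremePoints_of_tail_trivial hex fun A hA => ?_
    have hAm : MeasurableSet A :=
      inducedSigma_id_le _ _ (MeasurableSpace.measurableSet_iInf.1 hA 1)
    rw [Measure.map_apply hmeas hAm]
    refine h _ (MeasurableSpace.measurableSet_iInf.2 fun n => ?_)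
    obtain ⟨C, hC, rfl⟩ := MeasurableSpace.measurableSet_iInf.1 hA n
    exact ⟨C, hC, rfl⟩
  tfae_finish
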